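/- Proposition. Let $M$ be a combinatorial manifold: a (paracompact Hausdorff) topological $n$-manifold, possibly with boundary, with a PL structure, that is, a class of triangulations modulo PL homeomorphism, together with a simplicial complex $K$ and a PL homeomorphism $|K| \to M$, that is, a triangulation in the given class. Let $\mathcal P$ be the poset of simplices of $K$ ordered by the face relation, and give $M$ its native stratification $M \to \mathcal P$, which sends a point $x$ to the unique simplex whose interior contains $x$; it is continuous for the topology on $\mathcal P$ whose open sets are the upward closed sets. The entrance path category $\mathsf{Ent}(M,\mathcal P)$ has as objects the points of $M$. A morphism $x \to y$ is a class of entrance paths from $x$ to $y$, that is, of continuous paths $\gamma \colon [0,1] \to M$ from $x$ to $y$ such that for $s \le t$ the simplex of $\gamma(t)$ is a face of (possibly equal to) the simplex of $\gamma(s)$. Two entrance paths are identified when they are homotopic relative to their end points through entrance paths. Composition is concatenation. The combinatorial entrance path category $\mathsf{Ent}_\Delta(M,\mathcal P)$ has as objects the simplices of $K$, with exactly one morphism $\sigma \to \tau$ if $\tau$ is a face of $\sigma$, and none otherwise. Then there is an equivalence of categories $\mathsf{Ent}(M,\mathcal P) \xrightarrow{\sim} \mathsf{Ent}_\Delta(M,\mathcal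 P)$ that sends each point $x$ to the simplex whose interior contains $x$. -/

import Mathlib

universe u v w

/-! ### Stratified spaces and the entrance path category -/

/-- A stratification of a topological space `X` by a poset `P`: the space is paracompact and
Hausdorff, and the map `X → P` is continuous when `P` carries the topology whose open sets are
the upward closed sets. -/
structure Stratification (X : Type u) [TopologicalSpace X] (P : Type v) [PartialOrder P] where
  toFun : X → P
  t2Space : T2Space X
  paracompactSpace : ParacompactSpace X
  continuous_toFun : Continuous fun x => Topology.WithUpperSet.toUpperSet (toFun x)

namespace Stratification

open unitInterval

variable {X : Type u} [TopologicalSpace X] {P : Type v} [PartialOrder P]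

instance : CoeFun (Stratification X P) fun _ => X → P := ⟨Stratification.toFun⟩

/-- An entrance path: a continuous path which, as time increases, stays in its stratum or moves
into a deeper (that is, smaller) stratum. -/
structure EntrancePath (S : Stratification X P) (x y : X) where
  path : Path x y
  antitone : Antitone fun t : I => S (path t)

/-- An elementary homotopy between two entrance paths with the same end points: a homotopy relative
to the end points such that at every stage of the homotopy one has an entrance path. -/
def ElementaryHomotopic (S : Stratification X P) {x y : X} (p q : S.EntrancePath x y) : Prop :=
  ∃ H : Path.Homotopy p.path q.path, ∀ s : I, Antitone fun t : I => S (H.eval s t)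

namespace EntrancePath

variable {S : Stratification X P} {x y z : X}

/-- The constant entrance path. -/
def refl (S : Stratification X P) (x : X) : S.EntrancePath x x where
  path := Path.refl x
  antitone := fun _ _ _ => le_rfl

theorem antitone_trans {p : Path x y} {q : Path y z} (hp : Antitone fun t : I => S (p t))
    (hq : Antitone fun t : I => S (q t)) : Antitone fun t : I => S (p.trans q t) := by
  have h1 : ∀ t : I, S y ≤ S (p t) := fun t => by simpa using hp (show t ≤ 1 from le_one')
  have h2 : ∀ t : I, S (q t) ≤ S y := fun t => by simpa using hq (show 0 ≤ t from nonneg')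
  intro a b hab
  have hab' : (a : ℝ) ≤ b := hab
  simp only [Path.trans_apply]
  split_ifs with hb ha
  · exact hp (Subtype.mk_le_mk.2 (by linarith))
  · exact absurd (hab'.trans hb) ha
  · exact (h2 _).trans (h1 _)
  · exact hq (Subtype.mk_le_mk.2 (by linarith))

/-- Concatenation of entrance paths. -/
noncomputable def trans (p : S.EntrancePath x y) (q : S.EntrancePath y z) :
    S.EntrancePath x z where
  path := p.path.trans q.path
  antitone := antitone_trans p.antitone q.antitone

end EntrancePath

namespace ElementaryHomotopic

variable {S : Stratification X P} {x y z w : X}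

theorem refl (p : S.EntrancePath x y) : S.ElementaryHomotopic p p :=
  ⟨Path.Homotopy.refl p.path, fun _ => p.antitone⟩

theorem symm {p q : S.EntrancePath x y} (h : S.ElementaryHomotopic p q) :
    S.ElementaryHomotopic q p := by
  obtain ⟨H, hH⟩ := h
  exact ⟨H.symm, fun s => by simpa using hH (σ s)⟩

theorem trans {p q r : S.EntrancePath x y} (h : S.ElementaryHomotopic p q)
    (h' : S.ElementaryHomotopic q r) : S.ElementaryHomotopic p r := by
  obtain ⟨H, hH⟩ := h
  obtain ⟨G, hG⟩ := h'
  refine ⟨H.trans G, fun s a b hab => ?_⟩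
  have key : ∀ t : I, (H.trans G).eval s t = if h : (s : ℝ) ≤ 1 / 2 then
      H.eval ⟨2 * s, (unitInterval.mul_pos_mem_iff zero_lt_two).2 ⟨s.2.1, h⟩⟩ t
      else G.eval ⟨2 * s - 1, unitInterval.two_mul_sub_one_mem_iff.2 ⟨(not_le.1 h).le, s.2.2⟩⟩ t :=
    fun t => Path.Homotopy.trans_apply H G (s, t)
  simp only [key]
  split_ifs
  · exact hH _ hab
  · exact hG _ hab

theorem comp {p p' : S.EntrancePath x y} {q q' : S.EntrancePath y z}
    (h : S.ElementaryHomotopic p p') (h' : S.ElementaryHomotopic q q') :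
    S.ElementaryHomotopic (p.trans q) (p'.trans q') := by
  obtain ⟨H, hH⟩ := h
  obtain ⟨G, hG⟩ := h'
  refine ⟨H.hcomp G, fun s a b hab => ?_⟩
  have key : ∀ t : I, (H.hcomp G).eval s t = (H.eval s).trans (G.eval s) t := fun t =>
    (Path.Homotopy.hcomp_apply H G (s, t)).trans (Path.trans_apply _ _ t).symm
  exact (congrArg S (key b)).le.trans
    ((EntrancePath.antitone_trans (hH s) (hG s) hab).trans (congrArg S (key a)).ge)

theorem antitone_reparam {p : Path x y} (hp : Antitone fun t : I => S (p t)) {f : I → I}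
    (hf : Continuous f) (h0 : f 0 = 0) (h1 : f 1 = 1) (hm : Monotone f) (s : I) :
    Antitone fun t : I => S (Path.Homotopy.reparam p f hf h0 h1 (s, t)) := by
  intro a b hab
  refine hp (Subtype.mk_le_mk.2 ?_)
  have h2 : (f a : ℝ) ≤ f b := hm hab
  have h3 : (a : ℝ) ≤ b := hab
  exact add_le_add (mul_le_mul_of_nonneg_left h3 (σ s).2.1) (mul_le_mul_of_nonneg_left h2 s.2.1)

theorem monotone_transReflReparamAux {a b : I} (hab : a ≤ b) :
    Path.Homotopy.transReflReparamAux a ≤ Path.Homotopy.transReflReparamAux b := by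
  have h3 : (a : ℝ) ≤ b := hab
  unfold Path.Homotopy.transReflReparamAux
  split_ifs <;> linarith

theorem monotone_transAssocReparamAux {a b : I} (hab : a ≤ b) :
    Path.Homotopy.transAssocReparamAux a ≤ Path.Homotopy.transAssocReparamAux b := by
  have h3 : (a : ℝ) ≤ b := hab
  unfold Path.Homotopy.transAssocReparamAux
  split_ifs <;> linarith

theorem trans_refl (p : S.EntrancePath x y) :
    S.ElementaryHomotopic (p.trans (EntrancePath.refl S y)) p :=
  ⟨Path.Homotopy.transRefl p.path, fun s =>
    antitone_reparam p.antitone (by fun_prop)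
      (Subtype.ext Path.Homotopy.transReflReparamAux_zero)
      (Subtype.ext Path.Homotopy.transReflReparamAux_one)
      (fun _ _ hab => Subtype.mk_le_mk.2 (monotone_transReflReparamAux hab)) (σ s)⟩

theorem refl_trans (p : S.EntrancePath x y) :
    S.ElementaryHomotopic ((EntrancePath.refl S x).trans p) p := by
  refine ⟨Path.Homotopy.reflTrans p.path, fun s a b hab => ?_⟩
  refine p.antitone (symm_le_symm.2 (Subtype.mk_le_mk.2 ?_))
  have h2 : Path.Homotopy.transReflReparamAux (σ b) ≤ Path.Homotopy.transReflReparamAux (σ a) :=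
    monotone_transReflReparamAux (symm_le_symm.2 hab)
  have h3 : ((σ b : I) : ℝ) ≤ σ a := symm_le_symm.2 hab
  exact add_le_add (mul_le_mul_of_nonneg_left h3 (σ (σ s)).2.1)
    (mul_le_mul_of_nonneg_left h2 (σ s).2.1)

theorem assoc (p : S.EntrancePath x y) (q : S.EntrancePath y z) (r : S.EntrancePath z w) :
    S.ElementaryHomotopic ((p.trans q).trans r) (p.trans (q.trans r)) :=
  ⟨Path.Homotopy.transAssoc p.path q.path r.path, fun s =>
    antitone_reparam (p.trans (q.trans r)).antitone (by fun_prop)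
      (Subtype.ext Path.Homotopy.transAssocReparamAux_zero)
      (Subtype.ext Path.Homotopy.transAssocReparamAux_one)
      (fun _ _ hab => Subtype.mk_le_mk.2 (monotone_transAssocReparamAux hab)) (σ s)⟩

end ElementaryHomotopic

/-- Elementary homotopy is an equivalence relation on the entrance paths from `x` to `y`. -/
def entranceSetoid (S : Stratification X P) (x y : X) : Setoid (S.EntrancePath x y) where
  r := S.ElementaryHomotopic
  iseqv := ⟨ElementaryHomotopic.refl, ElementaryHomotopic.symm, ElementaryHomotopic.trans⟩

/-- The objects of the entrance path category: the points of `X`. -/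
structure Ent (S : Stratification X P) where
  pt : X

/-- The entrance path category: a morphism from `x` to `y` is an elementary homotopy class of
entrance paths from `x` to `y`, and composition is concatenation. -/
noncomputable instance (S : Stratification X P) : CategoryTheory.Category.{u} S.Ent where
  Hom x y := Quotient (S.entranceSetoid x.pt y.pt)
  id x := Quotient.mk _ (EntrancePath.refl S x.pt)
  comp f g := Quotient.map₂ EntrancePath.trans
    (fun _ _ h _ _ h' => ElementaryHomotopic.comp h h') f g
  id_comp := by rintro _ _ ⟨p⟩; exact Quotient.sound (ElementaryHomotopic.refl_trans p)
  comp_id := by rintro _ _ ⟨p⟩; exact Quotient.sound (ElementaryHomotopic.trans_refl p)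
  assoc := by
    rintro _ _ _ _ ⟨p⟩ ⟨q⟩ ⟨r⟩; exact Quotient.sound (ElementaryHomotopic.assoc p q r)

end Stratification

/-! ### Geometric realizations of simplicial complexes -/

namespace AbstractSimplicialComplex

variable {V : Type v} {W : Type w}

/-- The poset of simplices of `K`, ordered by the face relation. -/
abbrev Simplices (K : AbstractSimplicialComplex V) : Type v := {s : Finset V // s ∈ K.faces}

/-- The geometric realization of `K`: points are given by barycentric coordinates
whose support is a simplex. -/
def Realization (K : AbstractSimplicialComplex V) : Type v :=
  {x : V →₀ ℝ // x.support ∈ K.faces ∧ (∀ i, 0 ≤ x i) ∧ (x.sum fun _ r => r) = 1}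

namespace Realization

/-- The barycentric coordinates of a point. -/
def coords {K : AbstractSimplicialComplex V} (x : K.Realization) : V →₀ ℝ := x.1

/-- The simplex containing `x` in its interior (the open simplices partition the realization). -/
def carrier {K : AbstractSimplicialComplex V} (x : K.Realization) : K.Simplices :=
  ⟨x.coords.support, x.2.1⟩

end Realization

/-- The closed simplex spanned by `s`, as a subset of the realization. -/
def closedSimplex (K : AbstractSimplicialComplex V) (s : K.Simplices) : Set K.Realization :=
  {x | x.carrier ≤ s}

/-- The Euclidean topology on a closed simplex (all coordinates outside the simplex vanish). -/
abbrev euclideanTopology (K : AbstractSimplicialComplex V) (s : K.Simplices) :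
    TopologicalSpace (K.closedSimplex s) :=
  TopologicalSpace.induced (fun x (i : V) => x.1.coords i) inferInstance

/-- The weak topology: a set is open (closed) iff its intersection with every closed simplex is
open (closed) in the Euclidean topology of that simplex. -/
instance (K : AbstractSimplicialComplex V) : TopologicalSpace K.Realization :=
  ⨆ s : K.Simplices, TopologicalSpace.coinduced Subtype.val (K.euclideanTopology s)

theorem continuous_coords (K : AbstractSimplicialComplex V) (i : V) :
    Continuous fun x : K.Realization => x.coords i := by
  refine continuous_iSup_dom.2 fun s => continuous_coinduced_dom.2 ?_
  let := K.euclideanTopology s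
  exact (continuous_apply i).comp continuous_induced_dom

theorem continuous_carrier (K : AbstractSimplicialComplex V) :
    Continuous fun x : K.Realization => Topology.WithUpperSet.toUpperSet x.carrier := by
  refine continuous_def.2 fun U hU => ?_
  have hU' : IsUpperSet {s : K.Simplices | Topology.WithUpperSet.toUpperSet s ∈ U} := hU
  have : (fun x : K.Realization => Topology.WithUpperSet.toUpperSet x.carrier) ⁻¹' U =
      ⋃ t ∈ {s : K.Simplices | Topology.WithUpperSet.toUpperSet s ∈ U},
        ⋂ i ∈ t.1, {x : K.Realization | 0 < x.coords i} := by
    ext x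
    simp only [Set.mem_preimage, Set.mem_iUnion, Set.mem_iInter, Set.mem_ofPred_eq, exists_prop]
    constructor
    · intro hx
      exact ⟨x.carrier, hx, fun i hi =>
        lt_of_le_of_ne (x.2.2.1 i) (Ne.symm (Finsupp.mem_support_iff.1 hi))⟩
    · rintro ⟨t, ht, hx⟩
      exact hU' (show t ≤ x.carrier from fun i hi =>
        Finsupp.mem_support_iff.2 (hx i hi).ne') ht
  rw [this]
  exact isOpen_biUnion fun t _ => isOpen_biInter_finset fun i _ =>
    isOpen_lt continuous_const (K.continuous_coords i)

/-! ### Piecewise linear maps -/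

/-- `C` is a convex polytope in the closed simplex spanned by `s`: it is cut out by
finitely many affine inequalities. -/
def IsPolytope (K : AbstractSimplicialComplex V) (s : K.Simplices) (C : Set K.Realization) : Prop :=
  ∃ F : Set ((V →₀ ℝ) →ᵃ[ℝ] ℝ), F.Finite ∧
    C = {x | x ∈ K.closedSimplex s ∧ ∀ l ∈ F, 0 ≤ l x.coords}

/-- On `C`, the map `f` is affine with values in a closed simplex. -/
def IsAffineOn {K : AbstractSimplicialComplex V} {L : AbstractSimplicialComplex W}
    (f : K.Realization → L.Realization) (C : Set K.Realization) : Prop :=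
  ∃ (t : L.Simplices) (A : (V →₀ ℝ) →ᵃ[ℝ] (W →₀ ℝ)),
    ∀ x ∈ C, f x ∈ L.closedSimplex t ∧ (f x).coords = A x.coords

/-- A piecewise linear map: every closed simplex is a finite union of convex polytopes on
each of which the map is affine with values in a closed simplex. -/
def IsPL {K : AbstractSimplicialComplex V} {L : AbstractSimplicialComplex W}
    (f : K.Realization → L.Realization) : Prop :=
  ∀ s : K.Simplices, ∃ D : Set (Set K.Realization), D.Finite ∧ ⋃₀ D = K.closedSimplex s ∧
    ∀ C ∈ D, K.IsPolytope s C ∧ IsAffineOn f C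

theorem isPL_id (K : AbstractSimplicialComplex V) : IsPL (id : K.Realization → K.Realization) :=
  fun s => ⟨{K.closedSimplex s}, Set.finite_singleton _, Set.sUnion_singleton _, fun C hC => by
    rw [Set.mem_singleton_iff.1 hC]
    exact ⟨⟨∅, Set.finite_empty, by simp⟩, s, AffineMap.id ℝ _, fun x hx => ⟨hx, rfl⟩⟩⟩

theorem IsPL.comp {U : Type u} {K : AbstractSimplicialComplex V} {L : AbstractSimplicialComplex W}
    {N : AbstractSimplicialComplex U} {g : L.Realization → N.Realization}
    {f : K.Realization → L.Realization} (hg : IsPL g) (hf : IsPL f) : IsPL (g ∘ f) := by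
  intro s
  obtain ⟨D, hD, hDs, h⟩ := hf s
  choose hP t A hA using fun C hC => (show K.IsPolytope s C ∧ IsAffineOn f C from h C hC)
  choose E hE hEt h' using fun t => hg t
  refine ⟨⋃ C : D, (fun Q => C.1 ∩ f ⁻¹' Q) '' E (t C.1 C.2), ?_, ?_, ?_⟩
  · have := hD.to_subtype
    exact Set.finite_iUnion fun C => (hE _).image _
  · rw [← hDs]
    ext x
    simp only [Set.mem_sUnion, Set.mem_iUnion, Set.mem_image]
    constructor
    · rintro ⟨_, ⟨C, Q, hQ, rfl⟩, hx⟩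
      exact ⟨C.1, C.2, hx.1⟩
    · rintro ⟨C, hC, hx⟩
      have : f x ∈ ⋃₀ E (t C hC) := by rw [hEt]; exact (hA C hC x hx).1
      obtain ⟨Q, hQ, hxQ⟩ := this
      exact ⟨_, ⟨⟨C, hC⟩, Q, hQ, rfl⟩, hx, hxQ⟩
  · intro R hR
    obtain ⟨⟨C, hC⟩, Q, hQ, rfl⟩ := Set.mem_iUnion.1 hR
    obtain ⟨F, hF, hCF⟩ := hP C hC
    obtain ⟨⟨G, hG, hQG⟩, r, B, hB⟩ := h' _ Q hQ
    refine ⟨⟨F ∪ (fun l => l.comp (A C hC)) '' G, hF.union (hG.image _), ?_⟩,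
      r, B.comp (A C hC), fun x hx => ⟨(hB _ hx.2).1, ?_⟩⟩
    · ext x
      have hmem : x ∈ C ↔ x ∈ K.closedSimplex s ∧ ∀ l ∈ F, 0 ≤ l x.coords := by
        conv_lhs => rw [hCF]
        rfl
      have hmem' : x ∈ C → (f x ∈ Q ↔ ∀ l ∈ G, 0 ≤ l (A C hC x.coords)) := by
        intro hx
        conv_lhs => rw [hQG]
        simp [(hA C hC x hx).1, (hA C hC x hx).2]
      simp only [Set.mem_inter_iff, Set.mem_preimage, Set.mem_ofPred_eq, Set.mem_union,
        Set.mem_image]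
      constructor
      · rintro ⟨hx, hxQ⟩
        refine ⟨(hmem.1 hx).1, ?_⟩
        rintro l (hl | ⟨l, hl, rfl⟩)
        · exact (hmem.1 hx).2 l hl
        · exact (hmem' hx).1 hxQ l hl
      · rintro ⟨hx, hl⟩
        have hxC : x ∈ C := hmem.2 ⟨hx, fun l h => hl l (Or.inl h)⟩
        exact ⟨hxC, (hmem' hxC).2 fun l h => hl _ (Or.inr ⟨l, h, rfl⟩)⟩
    · show (g (f x)).coords = B (A C hC x.coords)
      rw [← (hA C hC x hx.1).2]
      exact (hB _ hx.2).2

end AbstractSimplicialComplex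

/-! ### Combinatorial manifolds -/

/-- A triangulation of `M`: a simplicial complex and a homeomorphism from its realization. -/
structure Triangulation (M : Type u) [TopologicalSpace M] where
  Vertex : Type v
  complex : AbstractSimplicialComplex Vertex
  homeo : complex.Realization ≃ₜ M

/-- Two triangulations of `M` are equivalent when the change of triangulation is a piecewise linear
homeomorphism. -/
instance Triangulation.setoid (M : Type u) [TopologicalSpace M] :
    Setoid (Triangulation.{u, v} M) where
  r T T' := AbstractSimplicialComplex.IsPL (fun x => T'.homeo.symm (T.homeo x)) ∧
    AbstractSimplicialComplex.IsPL (fun x => T.homeo.symm (T'.homeo x))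
  iseqv := by
    refine ⟨fun T => ?_, fun h => ⟨h.2, h.1⟩, fun {T T' T''} h h' => ?_⟩
    · have : (fun x => T.homeo.symm (T.homeo x)) = id := by ext x; simp
      rw [this]
      exact ⟨AbstractSimplicialComplex.isPL_id _, AbstractSimplicialComplex.isPL_id _⟩
    · constructor
      · have := h'.1.comp h.1
        simpa [Function.comp_def] using this
      · have := h.2.comp h'.2
        simpa [Function.comp_def] using this

/-- A topological `n`-manifold, possibly with boundary: a paracompact Hausdorff space every point
of which has an open neighbourhood homeomorphic to an open subset of the half-space of `ℝⁿ` on which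
the first coordinate is nonnegative (for `n = 0`, of the one-point space). -/
structure IsTopologicalManifold (n : ℕ) (M : Type u) [TopologicalSpace M] : Prop where
  t2Space : T2Space M
  paracompactSpace : ParacompactSpace M
  exists_chart : ∀ x : M, ∃ e : OpenPartialHomeomorph M
    {a : EuclideanSpace ℝ (Fin n) // ∀ i : Fin n, (i : ℕ) = 0 → 0 ≤ a i}, x ∈ e.source

/-- A piecewise linear manifold: a topological manifold with an equivalence class
of triangulations. -/
structure PLManifold (n : ℕ) (M : Type u) [TopologicalSpace M] where
  isTopologicalManifold : IsTopologicalManifold n M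
  plStructure : Quotient (Triangulation.setoid.{u, v} M)

/-- A combinatorial manifold: a piecewise linear manifold `M` with a simplicial complex `K` and a
piecewise linear homeomorphism from the realization of `K` to `M`, that is, a triangulation that
belongs to the given equivalence class. -/
structure CombinatorialManifold (n : ℕ) (M : Type u) [TopologicalSpace M] extends
    PLManifold.{u, v} n M where
  triangulation : Triangulation.{u, v} M
  isPL : Quotient.mk _ triangulation = plStructure

namespace CombinatorialManifold

variable {n : ℕ} {M : Type u} [TopologicalSpace M]

/-- The poset of strata of a combinatorial manifold: the simplices, ordered by the face relation. -/
abbrev Strata (X : CombinatorialManifold.{u, v} n M) : Type v := X.triangulation.complex.Simplices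

/-- The native stratification: a point is sent to the unique simplex that contains it in
its interior. -/
def nativeStratification (X : CombinatorialManifold.{u, v} n M) : Stratification M X.Strata where
  toFun x := (X.triangulation.homeo.symm x).carrier
  t2Space := X.isTopologicalManifold.t2Space
  paracompactSpace := X.isTopologicalManifold.paracompactSpace
  continuous_toFun :=
    X.triangulation.complex.continuous_carrier.comp X.triangulation.homeo.symm.continuous

/-- The objects of the combinatorial entrance path category: the strata. -/
structure CombinatorialEnt (X : CombinatorialManifold.{u, v} n M) where
  stratum : X.Strata

/-- The combinatorial entrance path category: there is exactly one morphism from `σ` to `τ` when `τ`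
is a face of `σ`, and none otherwise. -/
instance (X : CombinatorialManifold.{u, v} n M) :
    CategoryTheory.Category.{0} X.CombinatorialEnt where
  Hom σ τ := PLift (τ.stratum ≤ σ.stratum)
  id _ := ⟨le_rfl⟩
  comp f g := ⟨g.down.trans f.down⟩

end CombinatorialManifold

/-! Everything reduces to convexity of closed simplices. Carriers only shrink along an entrance
path, so a path starting at `x` stays in the closed simplex spanned by the carrier of `x`, where
points can be joined by segments.

If the carrier of `y` is a face of that of `x`, the segment from `x` to `y` is an entrance path
(`nonempty_entrancePath`): the functor is full. Two entrance paths from `x` to `y` lie in the same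
closed simplex, and the straight-line homotopy between them passes through entrance paths
(`elementaryHomotopic`): the functor is faithful. Barycenters give essential surjectivity. Both path
statements rest on the computation of the carrier of a point of a segment, `mem_carrier_segment`. -/

namespace AbstractSimplicialComplex

open unitInterval

variable {V : Type v} {K : AbstractSimplicialComplex V}

/-- A map into a closed simplex is continuous for the weak topology as soon as its barycentric
coordinates are continuous. -/
theorem continuous_of_continuous_coords {Z : Type*} [TopologicalSpace Z] {f : Z → K.Realization}
    (s : K.Simplices) (hs : ∀ z, (f z).carrier ≤ s)
    (hf : ∀ i, Continuous fun z => (f z).coords i) : Continuous f := by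
  let := K.euclideanTopology s
  -- The weak topology is a supremum of coinduced topologies, so each inclusion of a closed simplex
  -- is continuous.
  have hval : Continuous (Subtype.val : K.closedSimplex s → K.Realization) :=
    continuous_iff_coinduced_le.2 (le_iSup
      (fun s : K.Simplices => TopologicalSpace.coinduced Subtype.val (K.euclideanTopology s)) s)
  have hg : Continuous fun z => (⟨f z, hs z⟩ : K.closedSimplex s) :=
    continuous_induced_rng.2 (continuous_pi hf)
  exact hval.comp hg

/-! ### Segments in a closed simplex -/

namespace Realization

theorem coords_nonneg (x : K.Realization) (i : V) : 0 ≤ x.coords i := x.2.2.1 i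

theorem sum_coords (x : K.Realization) : (x.coords.sum fun _ r => r) = 1 := x.2.2.2

theorem coords_injective : Function.Injective (coords : K.Realization → V →₀ ℝ) :=
  Subtype.val_injective

theorem mem_carrier {x : K.Realization} {i : V} : i ∈ x.carrier.1 ↔ x.coords i ≠ 0 :=
  Finsupp.mem_support_iff

theorem sum_segment (x y : K.Realization) (t : I) :
    (((1 - (t : ℝ)) • x.coords + (t : ℝ) • y.coords).sum fun _ r => r) = 1 := by
  rw [Finsupp.sum_add_index' (fun _ => rfl) (fun _ _ _ => rfl),
    Finsupp.sum_smul_index (fun _ => rfl), Finsupp.sum_smul_index (fun _ => rfl),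
    ← Finsupp.mul_sum, ← Finsupp.mul_sum, sum_coords, sum_coords]
  ring

/-- The points of the straight line segment between two points of a closed simplex. -/
noncomputable def segment (s : K.Simplices) (x y : K.Realization) (hx : x.carrier ≤ s)
    (hy : y.carrier ≤ s) (t : I) : K.Realization := by
  refine ⟨(1 - (t : ℝ)) • x.coords + (t : ℝ) • y.coords, ?_, fun i => ?_, sum_segment x y t⟩
  · refine (K.isRelLowerSet_faces s.2).2 (fun i hi => ?_) (Finset.nonempty_iff_ne_empty.2 fun h => ?_)
    · by_contra his
      have hxi : x.coords i = 0 := not_not.1 fun h => his (hx (mem_carrier.2 h))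
      have hyi : y.coords i = 0 := not_not.1 fun h => his (hy (mem_carrier.2 h))
      simp [hxi, hyi] at hi
    -- An empty support would make the coordinates sum to 0 rather than 1.
    · have h1 := sum_segment x y t
      rw [Finsupp.support_eq_empty.1 h] at h1
      simp at h1
  · exact add_nonneg (mul_nonneg (sub_nonneg.2 t.2.2) (coords_nonneg x i))
      (mul_nonneg t.2.1 (coords_nonneg y i))

variable {s : K.Simplices} {x y : K.Realization} (hx : x.carrier ≤ s) (hy : y.carrier ≤ s)

theorem segment_coords (t : I) (i : V) :
    (segment s x y hx hy t).coords i = (1 - (t : ℝ)) * x.coords i + (t : ℝ) * y.coords i := rfl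

theorem segment_zero : segment s x y hx hy 0 = x :=
  coords_injective (Finsupp.ext fun i => by simp [segment_coords])

theorem segment_one : segment s x y hx hy 1 = y :=
  coords_injective (Finsupp.ext fun i => by simp [segment_coords])

theorem segment_self (hx' : x.carrier ≤ s) (t : I) : segment s x x hx hx' t = x :=
  coords_injective (Finsupp.ext fun i => by rw [segment_coords]; ring)

/-- Coordinates are nonnegative, so nothing cancels: a coordinate vanishes only if both weighted
terms do. The carrier is thus the union of the two carriers, except that an end point with weight 0
does not count. -/
theorem mem_carrier_segment {t : I} {i : V} : i ∈ (segment s x y hx hy t).carrier.1 ↔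
    (t ≠ 1 ∧ i ∈ x.carrier.1) ∨ (t ≠ 0 ∧ i ∈ y.carrier.1) := by
  have h1 : (1 - (t : ℝ)) = 0 ↔ t = 1 := by
    rw [sub_eq_zero, eq_comm]; exact Set.Icc.coe_eq_one
  have h0 : (t : ℝ) = 0 ↔ t = 0 := Set.Icc.coe_eq_zero
  rw [mem_carrier, mem_carrier, mem_carrier, segment_coords, Ne,
    add_eq_zero_iff_of_nonneg (mul_nonneg (sub_nonneg.2 t.2.2) (coords_nonneg x i))
      (mul_nonneg t.2.1 (coords_nonneg y i)), mul_eq_zero, mul_eq_zero, h1, h0]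
  tauto

theorem carrier_segment_le (t : I) : (segment s x y hx hy t).carrier ≤ s := fun _ hi =>
  ((mem_carrier_segment hx hy).1 hi).elim (fun h => hx h.2) fun h => hy h.2

/-- The segment from a point to a point whose carrier is a face of its carrier can only move into
a face at its end. -/
theorem antitone_carrier_segment (hyx : y.carrier ≤ x.carrier) :
    Antitone fun t : I => (segment s x y hx hy t).carrier := by
  intro a b hab i hi
  rcases (mem_carrier_segment hx hy).1 hi with ⟨hb, hi⟩ | ⟨hb, hi⟩
  · exact (mem_carrier_segment hx hy).2 (Or.inl ⟨fun ha => hb (le_antisymm le_one' (ha ▸ hab)), hi⟩)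
  -- Before time 1, a vertex of the carrier of `y` is already present as a vertex of the carrier of
  -- `x`.
  · by_cases ha : a = 1
    · exact (mem_carrier_segment hx hy).2 (Or.inr ⟨by simp [ha], hi⟩)
    · exact (mem_carrier_segment hx hy).2 (Or.inl ⟨ha, hyx hi⟩)

/-- Joining by segments two families of points whose carriers decrease gives, at each time, a family
of points whose carriers decrease. -/
theorem antitone_carrier_segment_of_antitone {T : Type*} [Preorder T] {f g : T → K.Realization}
    (hf : Antitone fun t => (f t).carrier) (hg : Antitone fun t => (g t).carrier)
    (hfs : ∀ t, (f t).carrier ≤ s) (hgs : ∀ t, (g t).carrier ≤ s) (a : I) :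
    Antitone fun t => (segment s (f t) (g t) (hfs t) (hgs t) a).carrier := by
  intro t t' h i hi
  -- The weights depend only on the fixed `a`, so the same carriers contribute at both times.
  exact (mem_carrier_segment _ _).2 (((mem_carrier_segment _ _).1 hi).imp
    (And.imp_right fun h' => hf h h') (And.imp_right fun h' => hg h h'))

/-- A single `s` contains all the segments, so continuity can be tested on coordinates. -/
theorem continuous_segment {Z : Type*} [TopologicalSpace Z] {f g : Z → K.Realization} {τ : Z → I}
    (hf : Continuous f) (hg : Continuous g) (hτ : Continuous τ)
    (hfs : ∀ z, (f z).carrier ≤ s) (hgs : ∀ z, (g z).carrier ≤ s) :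
    Continuous fun z => segment s (f z) (g z) (hfs z) (hgs z) (τ z) := by
  refine continuous_of_continuous_coords s (fun z => carrier_segment_le _ _ _) fun i => ?_
  have hfi : Continuous fun z => (f z).coords i := (K.continuous_coords i).comp hf
  have hgi : Continuous fun z => (g z).coords i := (K.continuous_coords i).comp hg
  simp only [segment_coords]
  fun_prop

/-- Every simplex is the carrier of a point, namely of its barycenter. -/
theorem carrier_surjective : Function.Surjective (carrier : K.Realization → K.Simplices) := by
  classical
  intro s
  have hs : s.1.Nonempty := (K.isRelLowerSet_faces s.2).1
  have hc : (0 : ℝ) < s.1.card := by exact_mod_cast hs.card_pos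
  let b : V →₀ ℝ := Finsupp.onFinset s.1 (fun i => if i ∈ s.1 then (s.1.card : ℝ)⁻¹ else 0)
    fun i hi => by_contra fun h => hi (if_neg h)
  have hb : ∀ i, b i = if i ∈ s.1 then (s.1.card : ℝ)⁻¹ else 0 := fun _ => rfl
  have hsupp : b.support = s.1 := by
    ext i
    rw [Finsupp.mem_support_iff, hb]
    split_ifs with h <;> simp [h, hc.ne']
  refine ⟨⟨b, hsupp ▸ s.2, fun i => ?_, ?_⟩, Subtype.ext hsupp⟩
  · rw [hb]
    split_ifs <;> positivity
  · rw [Finsupp.sum, hsupp, Finset.sum_congr rfl fun i hi => (hb i).trans (if_pos hi)]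
    simp [hc.ne']

end Realization

end AbstractSimplicialComplex

/-! ### The equivalence of categories -/

namespace CombinatorialManifold

open unitInterval AbstractSimplicialComplex CategoryTheory

variable {n : ℕ} {M : Type u} [TopologicalSpace M] (X : CombinatorialManifold.{u, v} n M)

theorem nonempty_entrancePath {x y : M}
    (h : X.nativeStratification y ≤ X.nativeStratification x) :
    Nonempty (X.nativeStratification.EntrancePath x y) := by
  let φ := X.triangulation.homeo
  have hx : (φ.symm x).carrier ≤ X.nativeStratification x := le_rfl
  have hy : (φ.symm y).carrier ≤ X.nativeStratification x := h
  refine ⟨⟨⟨⟨fun t => φ (Realization.segment _ _ _ hx hy t), φ.continuous.comp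
    (Realization.continuous_segment continuous_const continuous_const continuous_id _ _)⟩,
    ?_, ?_⟩, fun a b hab => ?_⟩⟩
  · simp [Realization.segment_zero]
  · simp [Realization.segment_one]
  · change (φ.symm (φ _)).carrier ≤ (φ.symm (φ _)).carrier
    simp only [Homeomorph.symm_apply_apply]
    exact Realization.antitone_carrier_segment hx hy h hab

theorem elementaryHomotopic {x y : M} (p q : X.nativeStratification.EntrancePath x y) :
    X.nativeStratification.ElementaryHomotopic p q := by
  let φ := X.triangulation.homeo
  -- Comparison with time 0 confines the whole path to the closed simplex of its starting point.
  have hle : ∀ (r : X.nativeStratification.EntrancePath x y) (t : I),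
      (φ.symm (r.path t)).carrier ≤ X.nativeStratification x := fun r t =>
    (r.antitone (show 0 ≤ t from nonneg')).trans_eq
      (congrArg X.nativeStratification r.path.source)
  let H : Path.Homotopy p.path q.path :=
    { toFun := fun z => φ (Realization.segment _ _ _ (hle p z.2) (hle q z.2) z.1)
      continuous_toFun := φ.continuous.comp (Realization.continuous_segment
        (φ.symm.continuous.comp (p.path.continuous.comp continuous_snd))
        (φ.symm.continuous.comp (q.path.continuous.comp continuous_snd)) continuous_fst _ _)
      map_zero_left := fun t => by simp [Realization.segment_zero]
      map_one_left := fun t => by simp [Realization.segment_one]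
      -- At times 0 and 1 the two paths agree, so the joining segment is constant.
      prop' := fun s t ht => by
        have hpq : q.path t = p.path t := by
          rcases ht with rfl | rfl <;> simp
        simp [hpq, Realization.segment_self] }
  refine ⟨H, fun s a b hab => ?_⟩
  change (φ.symm (φ (Realization.segment _ _ _ (hle p b) (hle q b) s))).carrier ≤
    (φ.symm (φ (Realization.segment _ _ _ (hle p a) (hle q a) s))).carrier
  rw [Homeomorph.symm_apply_apply, Homeomorph.symm_apply_apply]
  exact Realization.antitone_carrier_segment_of_antitone p.antitone q.antitone (hle p) (hle q) s hab

/-- The functor that sends a point to the simplex that contains it in its interior. -/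
def carrierFunctor : X.nativeStratification.Ent ⥤ X.CombinatorialEnt where
  obj x := ⟨X.nativeStratification x.pt⟩
  -- The functor laws are automatic, since the target's morphisms are lifted propositions.
  map f := ⟨by
    induction f using Quotient.ind with | _ p
    simpa using p.antitone (show (0 : I) ≤ 1 from zero_le_one)⟩

instance : X.carrierFunctor.Faithful where
  map_injective {_ _} f g _ := by
    induction f using Quotient.ind with | _ p
    induction g using Quotient.ind with | _ q
    exact Quotient.sound (X.elementaryHomotopic p q)

instance : X.carrierFunctor.Full where
  map_surjective f :=
    ⟨Quotient.mk _ (X.nonempty_entrancePath f.down).some, rfl⟩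

instance : X.carrierFunctor.EssSurj where
  mem_essImage c := by
    obtain ⟨x, hx⟩ := Realization.carrier_surjective c.stratum
    have h : X.carrierFunctor.obj ⟨X.triangulation.homeo x⟩ = c := by
      cases c
      exact congrArg CombinatorialEnt.mk
        ((congrArg Realization.carrier (X.triangulation.homeo.symm_apply_apply x)).trans hx)
    exact ⟨_, ⟨eqToIso h⟩⟩

instance : X.carrierFunctor.IsEquivalence where

end CombinatorialManifold

theorem mainTheorem11 {n : ℕ} {M : Type u} [TopologicalSpace M]
    (X : CombinatorialManifold.{u, v} n M) :
    ∃ e : CategoryTheory.Equivalence X.nativeStratification.Ent X.CombinatorialEnt,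
      ∀ x : M, e.functor.obj ⟨x⟩ = ⟨X.nativeStratification x⟩ :=
  ⟨X.carrierFunctor.asEquivalence, fun _ => rfl⟩
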